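/- Let $r \ge 2$ be an integer and let $C$ be the set of all $\mathbf n = (n_1,\dots,n_r) \in \mathbf Z^r$ with $0 < n_1 \le n_2 \le \dots \le n_r$. For $\mathbf n \in C$ let $a(\mathbf n)$ be the smallest index $i$ with $1 \le i \le r-2$ and $n_i = n_{i+1}$ if there is one, and let $a(\mathbf n) = r$ if there is none (that is, if $n_1 < n_2 < \dots < n_{r-1}$). Then $a(\mathbf n) \in \{1,2,\dots,r-2,r\}$ for all $\mathbf n\in C$, and $$\zeta(r) = \sum_{\mathbf n \in C} a(\mathbf n)\,\frac{2^{-n_r}}{n_1 n_2 \cdots n_r},$$ where the series converges absolutely. It converges rapidly: for every integer $N \ge 0$ there are at most $N^r$ elements $\mathbf n \in C$ with $n_r \le N$, and $$\Bigl|\zeta(r) - \sum_{\mathbf n \in C,\ n_r \le N} a(\mathbf n)\,\frac{2^{-n_r}}{n_1 n_2 \cdots n_r}\Bigr| \le r\,2^{-N}.$$ -/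

import Mathlib

/-- The index set of the series: the `r`-tuples of integers `0 < n_1 ≤ n_2 ≤ ⋯ ≤ n_r`.
Counting from one, `n_i` is `n ⟨i - 1, _⟩`. -/
def weaklyIncreasing (r : ℕ) : Set (Fin r → ℕ) :=
  {n | (∀ i, 0 < n i) ∧ Monotone n}

/-- `EqualityAt n i` says that `1 ≤ i ≤ r - 2` and `n_i = n_{i+1}`, the entries being counted
from one; so both entries are among `n_1, …, n_{r-1}`. -/
def EqualityAt {r : ℕ} (n : Fin r → ℕ) (i : ℕ) : Prop :=
  ∃ (_ : 1 ≤ i) (_ : i + 2 ≤ r), n ⟨i - 1, by omega⟩ = n ⟨i, by omega⟩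

open Classical in
/-- The coefficient `a(n)`: the smallest `i ≤ r - 2` with `n_i = n_{i+1}`, and `r` if there is
no such `i`. -/
noncomputable def coeffA {r : ℕ} (n : Fin r → ℕ) : ℕ :=
  if h : ∃ i, EqualityAt n i then Nat.find h else r

/-- The general term `a(n) 2^{-n_r} / (n_1 ⋯ n_r)` of the series. -/
noncomputable def seriesTerm (r : ℕ) (hr : 2 ≤ r) (n : Fin r → ℕ) : ℝ :=
  (coeffA n : ℝ) * ((2 : ℝ) ^ n ⟨r - 1, by omega⟩)⁻¹ / ∏ i, (n i : ℝ)

/-! Let `L_k`, `E_j`, `H_r` be the power series with coefficients `polylogCoeff k`, `elemCoeff j`,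
`hookCoeff r`, so that `L_k` is the polylogarithm and `E_j(x) = (-log(1-x))^j / j!`. Two identities
hold on `(0,1)`, each because the two sides have equal derivatives and the same limit at an
endpoint. One is `H_r(x) = ∑_{i<r} L_{r-i}(x) E_i(x)` (`powerSum_hookCoeff`, compared at `0`). The
other is `ζ(r) = ∑_{i<r} L_{r-i}(x) E_i(1-x) + Λ(1-x)`, where `Λ` has coefficients `elemCoeff (r-1)
m / m` (`zeta_eq_sum_polylog`, compared at `1`). At `x = 1/2` the two sums coincide, so `ζ(r) =
H_r(1/2) + Λ(1/2)` (`hasSum_zeta`). It remains to see that the coefficient of `2^{-m}` is the sum of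
`a(n) / (n_1 ⋯ n_r)` over the tuples with `n_r = m` (`sum_coeffA_eq`). Without its last entry, a
tuple `n` becomes a tuple `w`. Then `a(n)` is the number of nonempty strictly increasing initial
segments of `w`, plus one if `w` itself is strictly increasing (`coeffA_snoc`); the recursions for
`hookCoeff` and `elemCoeff` count exactly these. These coefficients are at most `r`, which bounds
the tail by a geometric series. -/

open Filter Topology Finset

/-! ### Coefficient sequences and uniform bounds. -/

/-- The sum of the power series with coefficients `c`. -/
noncomputable def powerSum (c : ℕ → ℝ) (x : ℝ) : ℝ := ∑' m, c m * x ^ m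

/-- `elemCoeff j m` is the sum of `1 / (n_1 ⋯ n_j)` over `0 < n_1 < ⋯ < n_j = m`. -/
noncomputable def elemCoeff : ℕ → ℕ → ℝ
  | 0, m => if m = 0 then 1 else 0
  | j + 1, m => (∑ p ∈ range m, elemCoeff j p) / m

/-- `hookCoeff r m` is the sum of `1 / (n_1 ⋯ n_r)` over all `1 ≤ j ≤ r` and all
`0 < n_1 < ⋯ < n_j ≤ n_{j+1} ≤ ⋯ ≤ n_r = m`. -/
noncomputable def hookCoeff : ℕ → ℕ → ℝ
  | 0, _ => 0
  | r + 1, m => (∑ p ∈ range (m + 1), hookCoeff r p + ∑ p ∈ range m, elemCoeff r p) / m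

/-- The coefficients of the polylogarithm of order `k`. -/
noncomputable def polylogCoeff (k m : ℕ) : ℝ := if m = 0 then 0 else 1 / (m : ℝ) ^ k

lemma elemCoeff_nonneg (j m : ℕ) : 0 ≤ elemCoeff j m := by
  induction j generalizing m with
  | zero => unfold elemCoeff; split_ifs <;> norm_num
  | succ j ih => exact div_nonneg (sum_nonneg fun p _ => ih p) m.cast_nonneg

lemma elemCoeff_le_one (j m : ℕ) : elemCoeff j m ≤ 1 := by
  induction j generalizing m with
  | zero => unfold elemCoeff; split_ifs <;> norm_num
  | succ j ih =>
    refine div_le_one_of_le₀ ?_ m.cast_nonneg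
    simpa using sum_le_sum fun p (_ : p ∈ range m) => ih p

lemma abs_elemCoeff_le (j m : ℕ) : |elemCoeff j m| ≤ 1 := by
  rw [abs_of_nonneg (elemCoeff_nonneg j m)]; exact elemCoeff_le_one j m

lemma abs_elemCoeff_div_le (j m : ℕ) : |elemCoeff j m / m| ≤ 1 := by
  rcases Nat.eq_zero_or_pos m with rfl | hm
  · simp
  · rw [abs_div, Nat.abs_cast]
    exact div_le_one_of_le₀ ((abs_elemCoeff_le _ _).trans (by exact_mod_cast hm)) m.cast_nonneg

lemma elemCoeff_succ_zero (j : ℕ) : elemCoeff (j + 1) 0 = 0 := by simp [elemCoeff]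

lemma hookCoeff_zero (r : ℕ) : hookCoeff r 0 = 0 := by cases r <;> simp [hookCoeff]

lemma hookCoeff_nonneg (r m : ℕ) : 0 ≤ hookCoeff r m := by
  induction r generalizing m with
  | zero => simp [hookCoeff]
  | succ r ih =>
    exact div_nonneg (add_nonneg (sum_nonneg fun p _ => ih p)
      (sum_nonneg fun p _ => elemCoeff_nonneg r p)) m.cast_nonneg

lemma hookCoeff_le (r m : ℕ) : hookCoeff r m ≤ r := by
  induction r generalizing m with
  | zero => simp [hookCoeff]
  | succ r ih =>
    refine div_le_of_le_mul₀ m.cast_nonneg (by positivity) ?_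
    -- The term `p = 0` vanishes, so `m` terms remain to be compared with the denominator `m`.
    rw [sum_range_succ', hookCoeff_zero]
    have h1 := sum_le_sum fun p (_ : p ∈ range m) => ih (p + 1)
    have h2 := sum_le_sum fun p (_ : p ∈ range m) => elemCoeff_le_one r p
    simp only [sum_const, card_range, nsmul_eq_mul] at h1 h2
    push_cast
    linarith

lemma abs_hookCoeff_le (r m : ℕ) : |hookCoeff r m| ≤ r := by
  rw [abs_of_nonneg (hookCoeff_nonneg r m)]; exact hookCoeff_le r m

lemma abs_polylogCoeff_le (k m : ℕ) : |polylogCoeff k m| ≤ 1 := by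
  unfold polylogCoeff
  split_ifs with h
  · simp
  · have : (1 : ℝ) ≤ m := by exact_mod_cast Nat.one_le_iff_ne_zero.2 h
    rw [abs_of_nonneg (by positivity)]
    exact div_le_one_of_le₀ (one_le_pow₀ this) (by positivity)

/-! ### Differentiation of power series with bounded coefficients. -/

lemma summable_powerSum {c : ℕ → ℝ} {B : ℝ} (hc : ∀ m, |c m| ≤ B) {x : ℝ} (hx : |x| < 1) :
    Summable fun m => ‖c m * x ^ m‖ := by
  refine Summable.of_nonneg_of_le (fun _ => norm_nonneg _) (fun m => ?_)
    ((summable_geometric_of_lt_one (abs_nonneg x) hx).mul_left B)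
  rw [norm_mul, norm_pow, Real.norm_eq_abs, Real.norm_eq_abs]
  exact mul_le_mul_of_nonneg_right (hc m) (by positivity)

lemma hasDerivAt_powerSum {c : ℕ → ℝ} {B : ℝ} (hc : ∀ m, |c m| ≤ B) {x : ℝ} (hx : |x| < 1) :
    HasDerivAt (powerSum c) (∑' m, c m * (m * x ^ (m - 1))) x := by
  -- A radius strictly between `|x|` and `1` gives a summable majorant of the derivatives, uniform
  -- on a ball containing `x`.
  obtain ⟨ρ, hxρ, hρ⟩ := exists_between hx
  have hρ0 : 0 < ρ := (abs_nonneg x).trans_lt hxρ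
  have hu : Summable fun m : ℕ => B * ((m : ℝ) * ρ ^ (m - 1)) := by
    refine Summable.mul_left B ?_
    have h := summable_pow_mul_geometric_of_norm_lt_one 1
      (show ‖ρ‖ < 1 by rwa [Real.norm_of_nonneg hρ0.le])
    refine (h.mul_left ρ⁻¹).congr fun m => ?_
    cases m with
    | zero => simp
    | succ m => simp only [Nat.add_sub_cancel, pow_succ, pow_zero]; field_simp
  refine hasDerivAt_tsum_of_isPreconnected (t := Metric.ball 0 ρ) (y₀ := 0) hu
    Metric.isOpen_ball (convex_ball 0 ρ).isPreconnected
    (fun m y _ => (hasDerivAt_pow m y).const_mul (c m)) (fun m y hy => ?_)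
    (Metric.mem_ball_self hρ0) (summable_powerSum hc (by simp)).of_norm (by simpa using hxρ)
  have hy' : |y| ≤ ρ := by simpa using (Metric.mem_ball.1 hy).le
  rw [norm_mul, norm_mul, norm_pow, Real.norm_eq_abs, Real.norm_eq_abs y, RCLike.norm_natCast]
  exact mul_le_mul (hc m) (by gcongr) (by positivity) ((abs_nonneg _).trans (hc m))

lemma powerSum_partialSums {c : ℕ → ℝ} {B : ℝ} (hc : ∀ m, |c m| ≤ B) {x : ℝ} (hx : |x| < 1) :
    HasSum (fun n => (∑ p ∈ range (n + 1), c p) * x ^ n) (powerSum c x / (1 - x)) := by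
  have hg : Summable fun m => ‖x ^ m‖ := by
    simpa using summable_geometric_of_lt_one (abs_nonneg x) hx
  have hf := summable_powerSum hc hx
  have h := (summable_norm_sum_mul_range_of_summable_norm hf hg).of_norm.hasSum
  rw [← tsum_mul_tsum_eq_tsum_sum_range_of_summable_norm hf hg, tsum_geometric_of_abs_lt_one hx,
    ← div_eq_mul_inv] at h
  refine HasSum.congr_fun h fun n => ?_
  rw [sum_mul]
  refine sum_congr rfl fun p hp => ?_
  rw [mul_assoc, ← pow_add, Nat.add_sub_cancel' (Nat.lt_succ_iff.1 (mem_range.1 hp))]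

/-- The derivative of a power series whose coefficients `d m` satisfy
`m * d m = c 0 + ⋯ + c (m - 1) + e m`. -/
lemma hasDerivAt_powerSum_of_recurrence {c d e : ℕ → ℝ} {B₁ B₂ B₃ : ℝ} (hc : ∀ m, |c m| ≤ B₁)
    (hd : ∀ m, |d m| ≤ B₂) (he : ∀ m, |e m| ≤ B₃)
    (h : ∀ m, m * d m = ∑ p ∈ range m, c p + e m) {x : ℝ} (hx0 : 0 < x) (hx1 : x < 1) :
    HasDerivAt (powerSum d) (powerSum c x / (1 - x) + powerSum e x / x) x := by
  have hx : |x| < 1 := by rwa [abs_of_pos hx0]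
  -- The recurrence at `m = 0` forces this, so division by `x` is a shift of the series.
  have he0 : e 0 = 0 := by simpa using (h 0).symm
  convert hasDerivAt_powerSum hd hx using 1
  have h1 := powerSum_partialSums hc hx
  have h2 : HasSum (fun n => e (n + 1) * x ^ n) (powerSum e x / x) := by
    have := (summable_powerSum he hx).of_norm.hasSum
    rw [← hasSum_nat_add_iff' 1] at this
    simp only [range_one, sum_singleton, he0, zero_mul, sub_zero] at this
    refine HasSum.congr_fun (this.div_const x) fun n => ?_
    rw [pow_succ]
    field_simp
  have h3 : HasSum (fun m => d m * (m * x ^ (m - 1)))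
      (powerSum c x / (1 - x) + powerSum e x / x) := by
    rw [← hasSum_nat_add_iff' 1]
    simp only [range_one, sum_singleton, Nat.cast_zero, zero_mul, mul_zero, sub_zero]
    refine HasSum.congr_fun (h1.add h2) fun n => ?_
    rw [← add_mul, ← h (n + 1), Nat.add_sub_cancel]
    ring
  exact h3.tsum_eq.symm

/-! ### Differential equations of the three families. -/

lemma powerSum_zero (c : ℕ → ℝ) : powerSum c 0 = c 0 := by
  unfold powerSum
  rw [tsum_eq_single 0 (fun m hm => by simp [hm])]
  simp

lemma powerSum_elemCoeff_zero (x : ℝ) : powerSum (elemCoeff 0) x = 1 := by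
  unfold powerSum
  rw [tsum_eq_single 0 (fun m hm => by simp [elemCoeff, hm])]
  simp [elemCoeff]

lemma powerSum_zero_coeff (x : ℝ) : powerSum (fun _ => 0) x = 0 := by simp [powerSum]

lemma hasDerivAt_elem (j : ℕ) {x : ℝ} (hx0 : 0 < x) (hx1 : x < 1) :
    HasDerivAt (powerSum (elemCoeff (j + 1))) (powerSum (elemCoeff j) x / (1 - x)) x := by
  convert hasDerivAt_powerSum_of_recurrence (e := fun _ => 0) (B₃ := 0) (abs_elemCoeff_le j)
    (abs_elemCoeff_le (j + 1)) (by simp) (fun m => ?_) hx0 hx1 using 1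
  · simp [powerSum_zero_coeff]
  · rcases Nat.eq_zero_or_pos m with rfl | hm
    · simp
    · rw [elemCoeff, mul_div_cancel₀ _ (by positivity), add_zero]

lemma hasDerivAt_hook (r : ℕ) {x : ℝ} (hx0 : 0 < x) (hx1 : x < 1) :
    HasDerivAt (powerSum (hookCoeff (r + 1)))
      ((powerSum (hookCoeff r) x + x * powerSum (elemCoeff r) x) / (x * (1 - x))) x := by
  have hx : |x| < 1 := by rwa [abs_of_pos hx0]
  -- The sum of `hookCoeff r` includes `p = m`; that last term is split off as `e`.
  convert hasDerivAt_powerSum_of_recurrence (c := fun m => hookCoeff r m + elemCoeff r m)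
    (e := hookCoeff r)
    (fun m => (abs_add_le _ _).trans (add_le_add (abs_hookCoeff_le r m) (abs_elemCoeff_le r m)))
    (abs_hookCoeff_le (r + 1)) (abs_hookCoeff_le r) (fun m => ?_) hx0 hx1 using 1
  · have : powerSum (fun m => hookCoeff r m + elemCoeff r m) x
        = powerSum (hookCoeff r) x + powerSum (elemCoeff r) x := by
      unfold powerSum
      rw [← (summable_powerSum (abs_hookCoeff_le r) hx).of_norm.tsum_add
        (summable_powerSum (abs_elemCoeff_le r) hx).of_norm]
      simp only [add_mul]
    have h1 : 1 - x ≠ 0 := by linarith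
    rw [this]
    field_simp
    ring
  · rcases Nat.eq_zero_or_pos m with rfl | hm
    · simp [hookCoeff_zero]
    · rw [hookCoeff, mul_div_cancel₀ _ (by positivity), sum_range_succ, sum_add_distrib]
      ring

lemma hasDerivAt_polylog (k : ℕ) {x : ℝ} (hx0 : 0 < x) (hx1 : x < 1) :
    HasDerivAt (powerSum (polylogCoeff (k + 1))) (powerSum (polylogCoeff k) x / x) x := by
  convert hasDerivAt_powerSum_of_recurrence (c := fun _ => 0) (B₁ := 0) (by simp)
    (abs_polylogCoeff_le (k + 1)) (abs_polylogCoeff_le k) (fun m => ?_) hx0 hx1 using 1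
  · simp [powerSum_zero_coeff]
  · rcases Nat.eq_zero_or_pos m with rfl | hm
    · simp [polylogCoeff]
    · simp only [polylogCoeff, hm.ne', if_false, sum_const_zero, zero_add]
      field_simp
      ring

lemma powerSum_polylog_zero {x : ℝ} (hx0 : 0 < x) (hx1 : x < 1) :
    powerSum (polylogCoeff 0) x = x / (1 - x) := by
  have h := (hasSum_geometric_of_lt_one hx0.le hx1).mul_left x
  have h2 : HasSum (fun m => polylogCoeff 0 m * x ^ m) (x / (1 - x)) := by
    rw [← hasSum_nat_add_iff' 1]
    simpa [polylogCoeff, pow_succ', div_eq_mul_inv] using h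
  exact h2.tsum_eq

lemma continuousAt_powerSum {c : ℕ → ℝ} {B : ℝ} (hc : ∀ m, |c m| ≤ B) {x : ℝ} (hx : |x| < 1) :
    ContinuousAt (powerSum c) x := (hasDerivAt_powerSum hc hx).continuousAt

/-- The filter stands for the one-sided approach to either endpoint, where the constant is
identified. -/
lemma eq_of_hasDerivAt_zero_of_tendsto {h : ℝ → ℝ} {l : ℝ} {F : Filter ℝ} [F.NeBot]
    (hF : Set.Ioo (0 : ℝ) 1 ∈ F) (hd : ∀ x ∈ Set.Ioo (0 : ℝ) 1, HasDerivAt h 0 x)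
    (ht : Tendsto h F (𝓝 l)) {x : ℝ} (hx : x ∈ Set.Ioo (0 : ℝ) 1) : h x = l := by
  obtain ⟨a, ha⟩ := isOpen_Ioo.exists_is_const_of_deriv_eq_zero isPreconnected_Ioo
    (fun y hy => (hd y hy).differentiableAt.differentiableWithinAt) (fun y hy => (hd y hy).deriv)
  have h1 : Tendsto h F (𝓝 a) :=
    tendsto_const_nhds.congr' (by filter_upwards [hF] with y hy using (ha y hy).symm)
  rw [ha x hx, tendsto_nhds_unique h1 ht]

/-- The product rule lowers either the polylogarithm or `b`, so the sum nearly reproduces itself.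
One computation serves both identities: `g = 1/(1-x)` for `b i = E_i(x)`, and `g = -1/x` for `b i =
E_i(1-x)`. -/
lemma hasDerivAt_sum_polylog_mul (r : ℕ) {b : ℕ → ℝ → ℝ} {g x : ℝ} (hx0 : 0 < x) (hx1 : x < 1)
    (h0 : HasDerivAt (b 0) 0 x) (hb : ∀ i, HasDerivAt (b (i + 1)) (g * b i x) x) :
    HasDerivAt (fun y => ∑ i ∈ range (r + 1), powerSum (polylogCoeff (r + 1 - i)) y * b i y)
      ((1 / x + g) * (∑ i ∈ range r, powerSum (polylogCoeff (r - i)) x * b i x)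
        + b r x / (1 - x)) x := by
  have key : ∀ i ∈ range (r + 1), HasDerivAt
      (fun y => powerSum (polylogCoeff (r + 1 - i)) y * b i y)
      (powerSum (polylogCoeff (r - i)) x / x * b i x + powerSum (polylogCoeff (r + 1 - i)) x *
        (if i = 0 then 0 else g * b (i - 1) x)) x := by
    intro i hi
    have hi' : r + 1 - i = (r - i) + 1 := by have := mem_range.1 hi; omega
    rw [hi']
    refine (hasDerivAt_polylog (r - i) hx0 hx1).mul ?_
    cases i with
    | zero => simpa using h0
    | succ i => simpa using hb i
  refine (HasDerivAt.fun_sum key).congr_deriv ?_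
  rw [sum_add_distrib, sum_range_succ, sum_range_succ' (fun i => powerSum (polylogCoeff (r + 1 - i)) x * _),
    Nat.sub_self, powerSum_polylog_zero hx0 hx1, add_mul, mul_sum, mul_sum]
  have e1 : x / (1 - x) / x * b r x = b r x / (1 - x) := by
    have : 1 - x ≠ 0 := by linarith
    field_simp
  have e2 : ∀ i, powerSum (polylogCoeff (r - i)) x / x * b i x
      = 1 / x * (powerSum (polylogCoeff (r - i)) x * b i x) := fun i => by ring
  have e3 : ∀ i, powerSum (polylogCoeff (r + 1 - (i + 1))) x * (g * b i x)
      = g * (powerSum (polylogCoeff (r - i)) x * b i x) := fun i => by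
    rw [Nat.add_sub_add_right]; ring
  simp only [e1, e2, if_true, mul_zero, add_zero, Nat.add_eq_zero_iff, one_ne_zero, and_false,
    if_false, Nat.add_sub_cancel, e3]
  ring

lemma hasDerivAt_elemCoeff_zero (x : ℝ) : HasDerivAt (powerSum (elemCoeff 0)) 0 x := by
  rw [show powerSum (elemCoeff 0) = fun _ => 1 from funext powerSum_elemCoeff_zero]
  exact hasDerivAt_const x 1

/-- By induction both sides have the same derivative, since `1/x + 1/(1-x) = 1/(x(1-x))`, and both
vanish at `0`. -/
lemma powerSum_hookCoeff (r : ℕ) {x : ℝ} (hx : x ∈ Set.Ioo (0 : ℝ) 1) :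
    powerSum (hookCoeff r) x
      = ∑ i ∈ range r, powerSum (polylogCoeff (r - i)) x * powerSum (elemCoeff i) x := by
  induction r generalizing x with
  | zero => simp [hookCoeff, powerSum]
  | succ r ih =>
    rw [← sub_eq_zero]
    refine eq_of_hasDerivAt_zero_of_tendsto (F := 𝓝[>] 0) (h := fun y => powerSum (hookCoeff (r + 1)) y
      - ∑ i ∈ range (r + 1), powerSum (polylogCoeff (r + 1 - i)) y * powerSum (elemCoeff i) y)
      (Ioo_mem_nhdsGT one_pos) (fun y hy => ?_) ?_ hx
    · have hy0 := hy.1.ne'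
      have hy1 : 1 - y ≠ 0 := by linarith [hy.2]
      refine ((hasDerivAt_hook r hy.1 hy.2).sub (hasDerivAt_sum_polylog_mul r (g := 1 / (1 - y))
        (b := fun i => powerSum (elemCoeff i)) hy.1 hy.2 (hasDerivAt_elemCoeff_zero y)
        (fun i => (hasDerivAt_elem i hy.1 hy.2).congr_deriv (by ring)))).congr_deriv ?_
      rw [← ih hy]
      field_simp
      ring
    · have h1 : ContinuousAt (fun y => powerSum (hookCoeff (r + 1)) y - ∑ i ∈ range (r + 1),
          powerSum (polylogCoeff (r + 1 - i)) y * powerSum (elemCoeff i) y) 0 := by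
        refine (continuousAt_powerSum (abs_hookCoeff_le _) (by simp)).sub
          (tendsto_finsetSum _ fun i _ => ?_)
        exact (continuousAt_powerSum (abs_polylogCoeff_le _) (by simp)).mul
          (continuousAt_powerSum (abs_elemCoeff_le _) (by simp))
      have h2 := h1.tendsto.mono_left (nhdsWithin_le_nhds (s := Set.Ioi 0))
      simpa [powerSum_zero, hookCoeff_zero, polylogCoeff] using h2

/-! ### Behaviour at `1` and the series for zeta at `1/2`. -/

lemma powerSum_polylog_one {x : ℝ} (hx0 : 0 < x) (hx1 : x < 1) :
    powerSum (polylogCoeff 1) x = -Real.log (1 - x) := by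
  have h := Real.hasSum_pow_div_log_of_abs_lt_one (show |x| < 1 by rwa [abs_of_pos hx0])
  have h2 : HasSum (fun m => polylogCoeff 1 m * x ^ m) (-Real.log (1 - x)) := by
    rw [← hasSum_nat_add_iff' 1]
    simpa [polylogCoeff, div_eq_inv_mul] using h
  exact h2.tsum_eq

lemma tendsto_powerSum_polylog (k : ℕ) :
    Tendsto (powerSum (polylogCoeff (k + 2))) (𝓝[<] 1) (𝓝 (∑' n : ℕ, 1 / (n : ℝ) ^ (k + 2))) := by
  have hs : Summable fun n : ℕ => 1 / (n : ℝ) ^ (k + 2) :=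
    Real.summable_one_div_nat_pow.2 (by omega)
  have hc : ∀ n, polylogCoeff (k + 2) n = 1 / (n : ℝ) ^ (k + 2) := fun n => by
    unfold polylogCoeff; split_ifs with h <;> simp [h]
  refine tendsto_tsum_of_dominated_convergence hs (fun n => ?_) ?_
  · rw [← hc]
    have : ContinuousAt (fun x : ℝ => polylogCoeff (k + 2) n * x ^ n) 1 := by fun_prop
    simpa using this.tendsto.mono_left nhdsWithin_le_nhds
  · filter_upwards [Ioo_mem_nhdsLT (zero_lt_one' ℝ)] with x hx n
    rw [hc, Real.norm_of_nonneg (by have := hx.1; positivity)]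
    exact mul_le_of_le_one_right (by positivity) (pow_le_one₀ hx.1.le hx.2.le)

/-- The logarithmic blow-up of `L_1` is beaten by the zero of `E_{j+1}(1-x)` at `x = 1`. -/
lemma tendsto_polylog_one_mul_elem (j : ℕ) :
    Tendsto (fun x => powerSum (polylogCoeff 1) x * powerSum (elemCoeff (j + 1)) (1 - x))
      (𝓝[<] 1) (𝓝 0) := by
  have h1 : Tendsto (fun x : ℝ => (1 - x) * Real.log (1 - x)) (𝓝[<] 1) (𝓝 0) := by
    have : Tendsto (fun x : ℝ => (1 - x) * Real.log (1 - x)) (𝓝 1) _ :=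
      (Real.continuous_mul_log.comp (continuous_const.sub continuous_id :
        Continuous fun x : ℝ => 1 - x)).tendsto 1
    simpa using this.mono_left nhdsWithin_le_nhds
  have hd := (hasDerivAt_powerSum (abs_elemCoeff_le (j + 1))
    (show |(0 : ℝ)| < 1 by simp)).isBigO_sub
  rw [powerSum_zero, elemCoeff_succ_zero] at hd
  have ht : Tendsto (fun x : ℝ => 1 - x) (𝓝[<] 1) (𝓝 0) := by
    have : Continuous fun x : ℝ => 1 - x := by fun_prop
    simpa using (this.tendsto 1).mono_left nhdsWithin_le_nhds
  have hO : (fun x : ℝ => powerSum (elemCoeff (j + 1)) (1 - x)) =O[𝓝[<] 1] fun x => 1 - x := by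
    simpa [Function.comp_def] using hd.comp_tendsto ht
  refine ((Asymptotics.isBigO_refl (powerSum (polylogCoeff 1)) (𝓝[<] 1)).mul hO).trans_tendsto ?_
  refine (neg_zero (G := ℝ) ▸ h1.neg).congr' ?_
  filter_upwards [Ioo_mem_nhdsLT (zero_lt_one' ℝ)] with x hx
  rw [powerSum_polylog_one hx.1 hx.2]
  ring

/-- Cutting the iterated integral for `ζ(r + 2)` at the point `x`. -/
lemma zeta_eq_sum_polylog (r : ℕ) {x : ℝ} (hx : x ∈ Set.Ioo (0 : ℝ) 1) :
    (∑ i ∈ range (r + 2), powerSum (polylogCoeff (r + 2 - i)) x * powerSum (elemCoeff i) (1 - x))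
      + powerSum (fun m => elemCoeff (r + 1) m / m) (1 - x) = ∑' n : ℕ, 1 / (n : ℝ) ^ (r + 2) := by
  have hB := abs_elemCoeff_div_le (r + 1)
  refine eq_of_hasDerivAt_zero_of_tendsto (F := 𝓝[<] 1) (h := fun x => (∑ i ∈ range (r + 2),
      powerSum (polylogCoeff (r + 2 - i)) x * powerSum (elemCoeff i) (1 - x))
      + powerSum (fun m => elemCoeff (r + 1) m / m) (1 - x))
      (Ioo_mem_nhdsLT one_pos) (fun y hy => ?_) ?_ hx
  · have hy0 := hy.1.ne'
    have hy1 : 1 - y ≠ 0 := by linarith [hy.2]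
    have hr : HasDerivAt (fun y : ℝ => 1 - y) (-1) y := by
      simpa using (hasDerivAt_id y).const_sub 1
    have h1y0 : 0 < 1 - y := by linarith [hy.2]
    have h1y1 : 1 - y < 1 := by linarith [hy.1]
    have hΛ := hasDerivAt_powerSum_of_recurrence (c := fun _ => 0) (B₁ := 0) (by simp) hB
      (abs_elemCoeff_le (r + 1)) (fun m => by
        rcases Nat.eq_zero_or_pos m with rfl | hm
        · simp [elemCoeff_succ_zero]
        · simp only [sum_const_zero, zero_add]
          field_simp) h1y0 h1y1
    refine ((hasDerivAt_sum_polylog_mul (r + 1) (g := -(1 / y))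
      (b := fun i y => powerSum (elemCoeff i) (1 - y)) hy.1 hy.2
      (by simpa [powerSum_elemCoeff_zero] using hasDerivAt_const y (1 : ℝ))
      (fun i => by
        refine ((hasDerivAt_elem i h1y0 h1y1).comp y hr).congr_deriv ?_
        rw [sub_sub_cancel]; ring)).add (hΛ.comp y hr)).congr_deriv ?_
    -- Here `1/y + g = 0`, and the remaining `E_{r+1}(1-y)/(1-y)` cancels the derivative of
    -- `Λ(1-y)`.
    rw [powerSum_zero_coeff]
    ring
  · have hE : ∀ j, Tendsto (fun x => powerSum (elemCoeff j) (1 - x)) (𝓝[<] 1)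
        (𝓝 (elemCoeff j 0)) := fun j => by
      have h1 : ContinuousAt (fun x : ℝ => powerSum (elemCoeff j) (1 - x)) 1 :=
        ContinuousAt.comp (g := powerSum (elemCoeff j))
          (continuousAt_powerSum (abs_elemCoeff_le j) (by simp)) (by fun_prop)
      simpa [powerSum_zero] using h1.tendsto.mono_left (nhdsWithin_le_nhds (s := Set.Iio 1))
    have hL : Tendsto (fun x => powerSum (fun m => elemCoeff (r + 1) m / m) (1 - x)) (𝓝[<] 1)
        (𝓝 0) := by
      have h1 : ContinuousAt (fun x : ℝ => powerSum (fun m => elemCoeff (r + 1) m / m) (1 - x)) 1 :=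
        ContinuousAt.comp (g := powerSum (fun m => elemCoeff (r + 1) m / m))
          (continuousAt_powerSum hB (by simp)) (by fun_prop)
      simpa [powerSum_zero] using h1.tendsto.mono_left (nhdsWithin_le_nhds (s := Set.Iio 1))
    -- The middle terms have polylogarithms of order at least `2`, with finite limits, times factors
    -- tending to `0`.
    have hM : Tendsto (fun x => ∑ i ∈ range r, powerSum (polylogCoeff (r + 2 - (i + 1))) x *
        powerSum (elemCoeff (i + 1)) (1 - x)) (𝓝[<] 1) (𝓝 (∑ i ∈ range r, 0)) := by
      refine tendsto_finsetSum _ fun i hi => ?_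
      have hi' : r + 2 - (i + 1) = (r - i - 1) + 2 := by have := mem_range.1 hi; omega
      rw [hi']
      simpa [elemCoeff_succ_zero] using (tendsto_powerSum_polylog (r - i - 1)).mul (hE (i + 1))
    have h0 : Tendsto (fun x => powerSum (polylogCoeff (r + 2)) x * powerSum (elemCoeff 0) (1 - x))
        (𝓝[<] 1) (𝓝 (∑' n : ℕ, 1 / (n : ℝ) ^ (r + 2))) := by
      simpa [elemCoeff] using (tendsto_powerSum_polylog r).mul (hE 0)
    have hall := ((hM.add (tendsto_polylog_one_mul_elem r)).add h0).add hL
    simp only [sum_const_zero, zero_add, add_zero] at hall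
    refine hall.congr fun x => ?_
    rw [sum_range_succ', sum_range_succ]
    congr 4
    simp

/-- The series of the coefficients obtained by summing over all tuples with a given last entry. -/
lemma hasSum_zeta (r : ℕ) :
    HasSum (fun m : ℕ => (hookCoeff (r + 2) m + elemCoeff (r + 1) m / m) * (2 ^ m)⁻¹)
      (∑' n : ℕ, 1 / (n : ℝ) ^ (r + 2)) := by
  have hx : (1 / 2 : ℝ) ∈ Set.Ioo (0 : ℝ) 1 := by norm_num
  have hx' : |(1 / 2 : ℝ)| < 1 := by norm_num [abs_of_pos]
  have hB := abs_elemCoeff_div_le (r + 1)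
  have h := zeta_eq_sum_polylog r hx
  -- The point `1/2` is fixed by `x ↦ 1 - x`, so the sum is the one evaluated by
  -- `powerSum_hookCoeff`.
  rw [show (1 : ℝ) - 1 / 2 = 1 / 2 by norm_num, ← powerSum_hookCoeff _ hx] at h
  have h2 := (summable_powerSum (abs_hookCoeff_le (r + 2)) hx').of_norm.hasSum.add
    (summable_powerSum hB hx').of_norm.hasSum
  rw [← h]
  refine HasSum.congr_fun h2 fun m => ?_
  rw [one_div, inv_pow]
  ring

/-! ### Tuples with prescribed last entry. -/

open Classical in
/-- The weakly increasing tuples of `s + 1` positive integers with last entry `m`. -/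
noncomputable def tuplesWithLast (s m : ℕ) : Finset (Fin (s + 1) → ℕ) :=
  {n ∈ Fintype.piFinset fun _ => Icc 1 m | Monotone n ∧ n (Fin.last s) = m}

lemma mem_tuplesWithLast {s m : ℕ} {n : Fin (s + 1) → ℕ} :
    n ∈ tuplesWithLast s m ↔ n ∈ weaklyIncreasing (s + 1) ∧ n (Fin.last s) = m := by
  unfold tuplesWithLast weaklyIncreasing
  simp only [mem_filter, Fintype.mem_piFinset, mem_Icc, Set.mem_ofPred_eq]
  constructor
  · rintro ⟨h1, h2, h3⟩
    exact ⟨⟨fun i => (h1 i).1, h2⟩, h3⟩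
  · rintro ⟨⟨h1, h2⟩, h3⟩
    exact ⟨fun i => ⟨h1 i, h3 ▸ h2 (Fin.le_last i)⟩, h2, h3⟩

lemma monotone_snoc {s m : ℕ} {w : Fin (s + 1) → ℕ} :
    Monotone (Fin.snoc w m : Fin (s + 2) → ℕ) ↔ Monotone w ∧ w (Fin.last s) ≤ m := by
  constructor
  · intro h
    refine ⟨fun i j hij => ?_, ?_⟩
    · simpa using h (Fin.castSucc_le_castSucc_iff.2 hij)
    · simpa using h (Fin.le_last (Fin.castSucc (Fin.last s)))
  · rintro ⟨h1, h2⟩ i j hij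
    induction j using Fin.lastCases with
    | last =>
      induction i using Fin.lastCases with
      | last => exact le_rfl
      | cast i => simpa using (h1 (Fin.le_last i)).trans h2
    | cast j =>
      induction i using Fin.lastCases with
      | last => exact absurd hij (by simp)
      | cast i => simpa using h1 (Fin.castSucc_le_castSucc_iff.1 hij)

lemma snoc_mem_tuplesWithLast {s m : ℕ} {w : Fin (s + 1) → ℕ} :
    (Fin.snoc w m : Fin (s + 2) → ℕ) ∈ tuplesWithLast (s + 1) m ↔
      w ∈ tuplesWithLast s (w (Fin.last s)) ∧ w (Fin.last s) ≤ m := by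
  simp only [mem_tuplesWithLast, weaklyIncreasing, Set.mem_ofPred_eq, monotone_snoc, Fin.snoc_last,
    Fin.forall_fin_succ', Fin.snoc_castSucc, and_true]
  constructor
  · rintro ⟨⟨⟨h1, h2⟩, h3⟩, h4, h5⟩
    exact ⟨⟨⟨h1, h2⟩, h4⟩, h5⟩
  · rintro ⟨⟨⟨h1, h2⟩, h4⟩, h5⟩
    exact ⟨⟨⟨h1, h2⟩, h2.trans_le h5⟩, h4, h5⟩

/-- The index `p` is the penultimate entry; `p = 0` contributes an empty sum. -/
lemma sum_tuplesWithLast_succ (s m : ℕ) (f : (Fin (s + 2) → ℕ) → ℝ) :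
    ∑ n ∈ tuplesWithLast (s + 1) m, f n
      = ∑ p ∈ range (m + 1), ∑ w ∈ tuplesWithLast s p, f (Fin.snoc w m) := by
  rw [sum_sigma']
  refine sum_bij' (fun n _ => ⟨Fin.init n (Fin.last s), Fin.init n⟩)
    (fun x _ => Fin.snoc x.2 m) ?_ ?_ ?_ ?_ ?_
  · intro n hn
    obtain rfl := (mem_tuplesWithLast.1 hn).2
    rw [← Fin.snoc_init_self n, Fin.snoc_last, snoc_mem_tuplesWithLast] at hn
    simpa [Nat.lt_succ_iff] using hn.symm
  · rintro ⟨p, w⟩ h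
    simp only [mem_sigma, mem_range, Nat.lt_succ_iff] at h
    obtain rfl := (mem_tuplesWithLast.1 h.2).2
    exact snoc_mem_tuplesWithLast.2 h.symm
  · intro n hn
    obtain rfl := (mem_tuplesWithLast.1 hn).2
    exact Fin.snoc_init_self n
  · rintro ⟨p, w⟩ h
    simp only [mem_sigma] at h
    obtain rfl := (mem_tuplesWithLast.1 h.2).2
    simp
  · intro n hn
    obtain rfl := (mem_tuplesWithLast.1 hn).2
    rw [Fin.snoc_init_self]

lemma sum_tuplesWithLast_zero (m : ℕ) (f : (Fin 1 → ℕ) → ℝ) :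
    ∑ n ∈ tuplesWithLast 0 m, f n = if m = 0 then 0 else f fun _ => m := by
  have h : tuplesWithLast 0 m = if m = 0 then ∅ else {fun _ => m} := by
    ext n
    have hi : ∀ i : Fin (0 + 1), i = Fin.last 0 := fun i => Subsingleton.elim (α := Fin 1) i _
    have hn : n = (fun _ => m) ↔ n (Fin.last 0) = m :=
      ⟨fun h => h ▸ rfl, fun h => funext fun i => by rw [hi i, h]⟩
    have hw : n ∈ weaklyIncreasing (0 + 1) ↔ 0 < n (Fin.last 0) :=
      ⟨fun h => h.1 _, fun h => ⟨fun i => by rwa [hi i], fun i j _ => by rw [hi i, hi j]⟩⟩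
    rw [mem_tuplesWithLast, hw]
    split_ifs with h0
    · simp only [notMem_empty, iff_false]; omega
    · rw [mem_singleton, hn]; omega
  rw [h]
  split_ifs <;> simp

/-! ### Adjacent equalities and the coefficient `a(n)`. -/

/-- `n_i = n_{i+1}`, the entries being counted from one. -/
def AdjacentEq {k : ℕ} (n : Fin k → ℕ) (i : ℕ) : Prop :=
  ∃ (_ : 1 ≤ i) (_ : i < k), n ⟨i - 1, by omega⟩ = n ⟨i, by omega⟩

open Classical in
/-- The indicator of the absence of equal adjacent entries. -/
noncomputable def strictInd {k : ℕ} (n : Fin k → ℕ) : ℕ := if ∀ i, ¬ AdjacentEq n i then 1 else 0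

open Classical in
/-- The length of the longest initial segment without equal adjacent entries. -/
noncomputable def runLength {k : ℕ} (n : Fin k → ℕ) : ℕ :=
  #{j ∈ range k | ∀ i ≤ j, ¬ AdjacentEq n i}

lemma adjacentEq_snoc {s m i : ℕ} {w : Fin (s + 1) → ℕ} :
    AdjacentEq (Fin.snoc w m : Fin (s + 2) → ℕ) i ↔
      AdjacentEq w i ∨ (i = s + 1 ∧ w (Fin.last s) = m) := by
  have key : ∀ j (hj : j < s + 2), (Fin.snoc w m : Fin (s + 2) → ℕ) ⟨j, hj⟩
      = if h : j < s + 1 then w ⟨j, h⟩ else m := fun j hj => by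
    unfold Fin.snoc
    simp [Fin.castLT]
  unfold AdjacentEq
  simp only [key]
  constructor
  · rintro ⟨h1, h2, h3⟩
    rw [dif_pos (by omega)] at h3
    split_ifs at h3 with h4
    · exact Or.inl ⟨h1, h4, h3⟩
    · have : i = s + 1 := by omega
      subst this
      exact Or.inr ⟨rfl, h3⟩
  · rintro (⟨h1, h2, h3⟩ | ⟨rfl, h3⟩)
    · refine ⟨h1, by omega, ?_⟩
      rw [dif_pos (by omega), dif_pos h2, h3]
    · refine ⟨by omega, by omega, ?_⟩
      rw [dif_pos (by omega), dif_neg (by omega), ← h3]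
      rfl

/-- The bound `i + 2 ≤ r` excludes the pair involving the last entry. -/
lemma equalityAt_snoc {s m i : ℕ} {w : Fin (s + 1) → ℕ} :
    EqualityAt (Fin.snoc w m : Fin (s + 2) → ℕ) i ↔ AdjacentEq w i := by
  have h : EqualityAt (Fin.snoc w m : Fin (s + 2) → ℕ) i ↔
      AdjacentEq (Fin.snoc w m : Fin (s + 2) → ℕ) i ∧ i ≤ s :=
    ⟨fun ⟨h1, h2, h3⟩ => ⟨⟨h1, by omega, h3⟩, by omega⟩,
      fun ⟨⟨h1, _, h3⟩, h2⟩ => ⟨h1, by omega, h3⟩⟩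
  rw [h, adjacentEq_snoc]
  constructor
  · rintro ⟨h1 | h1, h2⟩
    · exact h1
    · omega
  · intro h1
    exact ⟨Or.inl h1, by obtain ⟨_, h2, _⟩ := h1; omega⟩

lemma strictInd_snoc {s m : ℕ} (w : Fin (s + 1) → ℕ) :
    strictInd (Fin.snoc w m : Fin (s + 2) → ℕ) = if w (Fin.last s) = m then 0 else strictInd w := by
  have h : (∀ i, ¬ AdjacentEq (Fin.snoc w m : Fin (s + 2) → ℕ) i) ↔
      (∀ i, ¬ AdjacentEq w i) ∧ w (Fin.last s) ≠ m :=
    ⟨fun h => ⟨fun i hi => h i (adjacentEq_snoc.2 (Or.inl hi)),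
      fun hm => h (s + 1) (adjacentEq_snoc.2 (Or.inr ⟨rfl, hm⟩))⟩,
      fun h i hi => (adjacentEq_snoc.1 hi).elim (h.1 i) fun h' => h.2 h'.2⟩
  classical
  unfold strictInd
  rw [if_congr h rfl rfl]
  split_ifs <;> simp_all

/-- The one new index `s + 1` is counted exactly when the whole tuple has no equal neighbours. -/
lemma runLength_snoc {s m : ℕ} (w : Fin (s + 1) → ℕ) :
    runLength (Fin.snoc w m : Fin (s + 2) → ℕ)
      = runLength w + strictInd (Fin.snoc w m : Fin (s + 2) → ℕ) := by
  classical
  unfold runLength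
  rw [range_add_one, filter_insert]
  have h1 : {j ∈ range (s + 1) | ∀ i ≤ j, ¬ AdjacentEq (Fin.snoc w m : Fin (s + 2) → ℕ) i}
      = {j ∈ range (s + 1) | ∀ i ≤ j, ¬ AdjacentEq w i} := by
    refine filter_congr fun j hj => forall₂_congr fun i hi => not_congr ?_
    rw [adjacentEq_snoc]
    have := mem_range.1 hj
    constructor
    · rintro (h | h)
      · exact h
      · omega
    · exact Or.inl
  have h2 : (∀ i ≤ s + 1, ¬ AdjacentEq (Fin.snoc w m : Fin (s + 2) → ℕ) i) ↔
      ∀ i, ¬ AdjacentEq (Fin.snoc w m : Fin (s + 2) → ℕ) i :=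
    ⟨fun h i hi => h i (by obtain ⟨_, h2, _⟩ := hi; omega) hi, fun h i _ => h i⟩
  rw [h1]
  unfold strictInd
  by_cases h : ∀ i, ¬ AdjacentEq (Fin.snoc w m : Fin (s + 2) → ℕ) i
  · rw [if_pos (h2.2 h), if_pos h, card_insert_of_notMem (by simp)]
  · rw [if_neg (mt h2.1 h), if_neg h, add_zero]

/-- If the first equality in `w` is at `k`, the run has length `k` and the indicator is `0`; if
there is none, the value is `(s + 1) + 1`, the length of the full tuple. -/
lemma coeffA_snoc {s m : ℕ} (w : Fin (s + 1) → ℕ) :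
    coeffA (Fin.snoc w m : Fin (s + 2) → ℕ) = runLength w + strictInd w := by
  classical
  unfold coeffA runLength strictInd
  split_ifs with h h' h'
  · obtain ⟨i, hi⟩ := h
    exact absurd (equalityAt_snoc.1 hi) (h' i)
  · have h1 := Nat.find_spec h
    set k := Nat.find h with hk
    have hks : k ≤ s := by obtain ⟨_, h2, _⟩ := h1; omega
    have : {j ∈ range (s + 1) | ∀ i ≤ j, ¬ AdjacentEq w i} = range k := by
      ext j
      simp only [mem_filter, mem_range]
      constructor
      · rintro ⟨_, h3⟩
        by_contra! h4
        exact h3 k h4 (equalityAt_snoc.1 h1)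
      · intro hj
        refine ⟨by omega, fun i hi h3 => ?_⟩
        exact Nat.find_min h (show i < Nat.find h by omega) (equalityAt_snoc.2 h3)
    rw [this, card_range, add_zero]
  · rw [filter_true_of_mem fun j _ i _ => h' i, card_range]
  · exact absurd (fun i hi => h ⟨i, equalityAt_snoc.2 hi⟩) h'

lemma not_adjacentEq_one (n : Fin 1 → ℕ) (i : ℕ) : ¬ AdjacentEq n i := by
  rintro ⟨h1, h2, _⟩
  omega

lemma prod_snoc_cast {s m : ℕ} (w : Fin (s + 1) → ℕ) :
    ∏ i, ((Fin.snoc w m : Fin (s + 2) → ℕ) i : ℝ) = (∏ i, (w i : ℝ)) * m := by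
  rw [Fin.prod_univ_castSucc]
  simp

lemma sum_strictInd (s m : ℕ) :
    ∑ n ∈ tuplesWithLast s m, (strictInd n : ℝ) / ∏ i, (n i : ℝ) = elemCoeff (s + 1) m := by
  induction s generalizing m with
  | zero =>
    rw [sum_tuplesWithLast_zero]
    rcases Nat.eq_zero_or_pos m with rfl | hm
    · simp [elemCoeff]
    · simp [elemCoeff, strictInd, not_adjacentEq_one, hm.ne', hm]
  | succ s ih =>
    -- The term `p = m` drops out because it repeats the last entry, which leaves the strict sum.
    rw [sum_tuplesWithLast_succ, elemCoeff, sum_div, sum_range_succ, add_eq_left.2 (sum_eq_zero ?_)]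
    · refine sum_congr rfl fun p hp => ?_
      rw [← ih, sum_div]
      refine sum_congr rfl fun w hw => ?_
      rw [prod_snoc_cast, strictInd_snoc, if_neg, div_div]
      rw [(mem_tuplesWithLast.1 hw).2]
      exact (mem_range.1 hp).ne
    · intro w hw
      rw [strictInd_snoc, if_pos (mem_tuplesWithLast.1 hw).2]
      simp

lemma sum_runLength (s m : ℕ) :
    ∑ n ∈ tuplesWithLast s m, (runLength n : ℝ) / ∏ i, (n i : ℝ) = hookCoeff (s + 1) m := by
  induction s generalizing m with
  | zero =>
    rw [sum_tuplesWithLast_zero]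
    rcases Nat.eq_zero_or_pos m with rfl | hm
    · simp [hookCoeff]
    · simp [hookCoeff, elemCoeff, runLength, not_adjacentEq_one, hm.ne', hm]
  | succ s ih =>
    have h := sum_strictInd (s + 1) m
    rw [elemCoeff] at h
    rw [hookCoeff, add_div]
    have h2 : ∑ n ∈ tuplesWithLast (s + 1) m, (runLength n : ℝ) / ∏ i, (n i : ℝ)
        = (∑ p ∈ range (m + 1), ∑ w ∈ tuplesWithLast s p,
            (runLength w : ℝ) / ∏ i, ((Fin.snoc w m : Fin (s + 2) → ℕ) i : ℝ))
          + ∑ n ∈ tuplesWithLast (s + 1) m, (strictInd n : ℝ) / ∏ i, (n i : ℝ) := by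
      rw [sum_tuplesWithLast_succ, sum_tuplesWithLast_succ, ← sum_add_distrib]
      refine sum_congr rfl fun p _ => ?_
      rw [← sum_add_distrib]
      refine sum_congr rfl fun w _ => ?_
      rw [runLength_snoc, Nat.cast_add, add_div]
    rw [h2, h]
    congr 1
    rw [sum_div]
    refine sum_congr rfl fun p _ => ?_
    rw [← ih, sum_div]
    refine sum_congr rfl fun w _ => ?_
    rw [prod_snoc_cast, div_div]

/-- The sum of `a(n) / (n_1 ⋯ n_r)` over all tuples with last entry `m`. -/
lemma sum_coeffA (s m : ℕ) :
    ∑ n ∈ tuplesWithLast (s + 1) m, (coeffA n : ℝ) / ∏ i, (n i : ℝ)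
      = (∑ p ∈ range (m + 1), (hookCoeff (s + 1) p + elemCoeff (s + 1) p)) / m := by
  rw [sum_tuplesWithLast_succ, sum_div]
  refine sum_congr rfl fun p _ => ?_
  rw [← sum_runLength, ← sum_strictInd, ← sum_add_distrib, sum_div]
  refine sum_congr rfl fun w _ => ?_
  rw [coeffA_snoc, prod_snoc_cast, Nat.cast_add, ← add_div, div_div]

lemma sum_coeffA_eq (s m : ℕ) :
    ∑ n ∈ tuplesWithLast (s + 1) m, (coeffA n : ℝ) / ∏ i, (n i : ℝ)
      = hookCoeff (s + 2) m + elemCoeff (s + 1) m / m := by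
  rw [sum_coeffA, hookCoeff, sum_add_distrib, sum_range_succ (elemCoeff (s + 1))]
  ring

lemma sum_coeffA_le (s m : ℕ) :
    ∑ n ∈ tuplesWithLast (s + 1) m, (coeffA n : ℝ) / ∏ i, (n i : ℝ) ≤ (s + 2 : ℕ) := by
  rw [sum_coeffA]
  refine div_le_of_le_mul₀ m.cast_nonneg (by positivity) ?_
  -- Without the zero term `p = 0` there are `m` terms, each at most `(s + 1) + 1`.
  rw [sum_range_succ', hookCoeff_zero, elemCoeff_succ_zero]
  have h := sum_le_sum fun p (_ : p ∈ range m) =>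
    add_le_add (hookCoeff_le (s + 1) (p + 1)) (elemCoeff_le_one (s + 1) (p + 1))
  simp only [sum_const, card_range, nsmul_eq_mul] at h
  push_cast at h ⊢
  linarith

/-! ### Summation over all tuples and the error bound. -/

lemma seriesTerm_eq (s : ℕ) (hr : 2 ≤ s + 2) (n : Fin (s + 2) → ℕ) :
    seriesTerm (s + 2) hr n
      = (coeffA n : ℝ) / (∏ i, (n i : ℝ)) * (2 ^ n (Fin.last (s + 1)))⁻¹ := by
  unfold seriesTerm
  rw [show (⟨s + 2 - 1, by omega⟩ : Fin (s + 2)) = Fin.last (s + 1) from rfl]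
  ring

lemma seriesTerm_nonneg (s : ℕ) (hr : 2 ≤ s + 2) (n : Fin (s + 2) → ℕ) :
    0 ≤ seriesTerm (s + 2) hr n := by
  rw [seriesTerm_eq]; positivity

lemma sum_seriesTerm (s : ℕ) (hr : 2 ≤ s + 2) (m : ℕ) :
    ∑ n ∈ tuplesWithLast (s + 1) m, seriesTerm (s + 2) hr n
      = (hookCoeff (s + 2) m + elemCoeff (s + 1) m / m) * (2 ^ m)⁻¹ := by
  rw [← sum_coeffA_eq, sum_mul]
  refine sum_congr rfl fun n hn => ?_
  rw [seriesTerm_eq, (mem_tuplesWithLast.1 hn).2]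

lemma hasSum_seriesTerm (s : ℕ) (hr : 2 ≤ s + 2) :
    HasSum (fun n : weaklyIncreasing (s + 2) => seriesTerm (s + 2) hr n)
      (∑' n : ℕ, 1 / (n : ℝ) ^ (s + 2)) := by
  -- Grouping by the last entry gives finite fibres; as the terms are nonnegative, summability of
  -- the fibre sums suffices.
  let e := Equiv.sigmaFiberEquiv fun n : weaklyIncreasing (s + 2) => n.1 (Fin.last (s + 1))
  have hfib : ∀ m : ℕ, HasSum
      (fun c : {n : weaklyIncreasing (s + 2) // n.1 (Fin.last (s + 1)) = m} =>
        seriesTerm (s + 2) hr c.1)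
      ((hookCoeff (s + 2) m + elemCoeff (s + 1) m / m) * (2 ^ m)⁻¹) := fun m => by
    let f : {n : weaklyIncreasing (s + 2) // n.1 (Fin.last (s + 1)) = m} ≃
        tuplesWithLast (s + 1) m :=
      { toFun := fun c => ⟨c.1.1, mem_tuplesWithLast.2 ⟨c.1.2, c.2⟩⟩
        invFun := fun n => ⟨⟨n.1, (mem_tuplesWithLast.1 n.2).1⟩, (mem_tuplesWithLast.1 n.2).2⟩
        left_inv := fun _ => rfl
        right_inv := fun _ => rfl }
    rw [← sum_seriesTerm s hr m]
    exact (f.hasSum_iff (f := fun n : tuplesWithLast (s + 1) m => seriesTerm (s + 2) hr n.1)).2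
      (Finset.hasSum (tuplesWithLast (s + 1) m) (seriesTerm (s + 2) hr))
  rw [← e.hasSum_iff]
  have hsum : Summable ((fun n : weaklyIncreasing (s + 2) => seriesTerm (s + 2) hr n) ∘ e) := by
    refine (summable_sigma_of_nonneg fun x => seriesTerm_nonneg s hr _).2
      ⟨fun m => (hfib m).summable, ?_⟩
    refine (hasSum_zeta s).summable.congr fun m => ?_
    exact (hfib m).tsum_eq.symm
  have := HasSum.sigma hsum.hasSum hfib
  rw [(hasSum_zeta s).unique this]
  exact hsum.hasSum

lemma riemannZeta_eq_ofReal (s : ℕ) :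
    riemannZeta (s + 2 : ℕ) = ((∑' n : ℕ, 1 / (n : ℝ) ^ (s + 2) : ℝ) : ℂ) := by
  rw [zeta_nat_eq_tsum_of_gt_one (by omega)]
  push_cast
  rfl

lemma zeta_sub_sum_le (s : ℕ) (N : ℕ) :
    |(∑' n : ℕ, 1 / (n : ℝ) ^ (s + 2)) - ∑ m ∈ range (N + 1),
      (hookCoeff (s + 2) m + elemCoeff (s + 1) m / m) * (2 ^ m)⁻¹| ≤ (s + 2 : ℕ) * (2 ^ N)⁻¹ := by
  have h := (hasSum_nat_add_iff' (N + 1)).2 (hasSum_zeta s)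
  have hg : HasSum (fun m : ℕ => ((s + 2 : ℕ) : ℝ) * (2 ^ (m + (N + 1)))⁻¹)
      ((s + 2 : ℕ) * (2 ^ N)⁻¹) := by
    have h1 := hasSum_geometric_two.mul_left (((s + 2 : ℕ) : ℝ) * (2 ^ (N + 1))⁻¹)
    rw [show ((s + 2 : ℕ) : ℝ) * (2 ^ (N + 1))⁻¹ * 2 = (s + 2 : ℕ) * (2 ^ N)⁻¹ by
      rw [pow_succ]; ring] at h1
    refine HasSum.congr_fun h1 fun m => ?_
    rw [pow_add, mul_inv, one_div, inv_pow]
    ring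
  rw [abs_of_nonneg]
  · refine hasSum_le (fun m => ?_) h hg
    rw [← sum_coeffA_eq]
    exact mul_le_mul_of_nonneg_right (sum_coeffA_le s _) (by positivity)
  · exact h.nonneg fun m => mul_nonneg (add_nonneg (hookCoeff_nonneg _ _)
      (div_nonneg (elemCoeff_nonneg _ _) (Nat.cast_nonneg _))) (by positivity)

theorem corollary12 (r : ℕ) (hr : 2 ≤ r) :
    -- the coefficients take values in `{1, …, r - 2, r}`
    (∀ n ∈ weaklyIncreasing r, (1 ≤ coeffA n ∧ coeffA n + 2 ≤ r) ∨ coeffA n = r) ∧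
    -- the series converges (absolutely), with sum `ζ(r)`
    HasSum (fun n : weaklyIncreasing r => ((seriesTerm r hr n : ℝ) : ℂ)) (riemannZeta r) ∧
    -- rapid convergence: the at most `N ^ r` terms with `n_r ≤ N` give `ζ(r)` up to `r 2 ^ (-N)`
    (∀ N : ℕ, ∃ T : Finset (Fin r → ℕ),
      (∀ n, n ∈ T ↔ n ∈ weaklyIncreasing r ∧ n ⟨r - 1, by omega⟩ ≤ N) ∧
      T.card ≤ N ^ r ∧
      ‖riemannZeta r - ((∑ n ∈ T, seriesTerm r hr n : ℝ) : ℂ)‖ ≤ r * ((2 : ℝ) ^ N)⁻¹) := by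
  classical
  obtain ⟨s, rfl⟩ : ∃ s, r = s + 2 := ⟨r - 2, by omega⟩
  refine ⟨fun n _ => ?_, ?_, fun N => ?_⟩
  · unfold coeffA
    split_ifs with h
    · obtain ⟨h1, h2, _⟩ := Nat.find_spec h
      exact Or.inl ⟨h1, h2⟩
    · exact Or.inr rfl
  · rw [riemannZeta_eq_ofReal]
    exact_mod_cast hasSum_seriesTerm s hr
  · have hT : ∀ n, n ∈ (range (N + 1)).biUnion (tuplesWithLast (s + 1)) ↔
        n ∈ weaklyIncreasing (s + 2) ∧ n (Fin.last (s + 1)) ≤ N := fun n => by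
      simp only [mem_biUnion, mem_range, Nat.lt_succ_iff, mem_tuplesWithLast]
      constructor
      · rintro ⟨m, hm, h1, rfl⟩
        exact ⟨h1, hm⟩
      · rintro ⟨h1, h2⟩
        exact ⟨_, h2, h1, rfl⟩
    refine ⟨(range (N + 1)).biUnion (tuplesWithLast (s + 1)), hT, ?_, ?_⟩
    · have hsub : (range (N + 1)).biUnion (tuplesWithLast (s + 1)) ⊆
          Fintype.piFinset fun _ : Fin (s + 2) => Icc 1 N := fun n hn => by
        obtain ⟨⟨h1, h2⟩, h3⟩ := (hT n).1 hn
        exact Fintype.mem_piFinset.2 fun i =>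
          mem_Icc.2 ⟨h1 i, (h2 (Fin.le_last i)).trans h3⟩
      simpa using card_le_card hsub
    · rw [sum_biUnion]
      · simp only [sum_seriesTerm]
        rw [riemannZeta_eq_ofReal, ← Complex.ofReal_sub, Complex.norm_real, Real.norm_eq_abs]
        exact zeta_sub_sum_le s N
      · intro a _ b _ hab
        refine disjoint_left.2 fun n h1 h2 => hab ?_
        rw [← (mem_tuplesWithLast.1 h1).2, (mem_tuplesWithLast.1 h2).2]
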